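/- Conventions. Composition is written diagrammatically. A tangent structure $\mathbb{T}$ on a category $\mathbb{X}$ (in the sense of Rosický and Cockett–Cruttwell) consists of an endofunctor $\mathrm{T}$, a natural projection $p\colon \mathrm{T}\Rightarrow\mathrm{id}$ all of whose finite pullback powers $\mathrm{T}_nM$ exist and are preserved by every iterate $\mathrm{T}^m$, a zero $z\colon\mathrm{id}\Rightarrow\mathrm{T}$ and an addition $+\colon\mathrm{T}_2\Rightarrow\mathrm{T}$ making each $p\colon\mathrm{T}M\to M$ an additive bundle (a commutative monoid in the slice over $M$), a vertical lift $l\colon\mathrm{T}\Rightarrow\mathrm{T}^2$ and a canonical flip $c\colon\mathrm{T}^2\Rightarrow\mathrm{T}^2$, subject to the usual coherence axioms and to the universality of the vertical lift. It has negatives if there is a natural transformation $n\colon\mathrm{T}\Rightarrow\mathrm{T}$ with $np=p$ and $\langle\mathrm{id},n\rangle{+}=pz$. A $\mathrm{T}$-pullback is a pullback square preserved by all iterates $\mathrm{T}^m$. A tangent display map is a morphism $q$ such that, for every $n\ge 0$, the pullback of $\mathrm{T}^nq$ along every morphism into its codomain exists and is a $\mathrm{T}$-pullback. The tangent category is well-displayed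 if every $p\colon \mathrm{T}M\to M$ is a tangent display map. A differential bundle is an additive bundle $(q\colon E\to M,\ z_q\colon M\to E,\ s_q\colon E_2\to E)$, whose finite pullback powers exist and are preserved by all $\mathrm{T}^m$, together with $l_q\colon E\to\mathrm{T}E$ such that $(l_q,z)\colon(q,z_q,s_q)\to(\mathrm{T}q,\mathrm{T}z_q,\mathrm{T}s_q)$ and $(l_q,z_q)\colon(q,z_q,s_q)\to(p,z,+)$ are additive bundle morphisms, $l_q\,l=l_q\,\mathrm{T}l_q$, and the square with top $(l_q\times_M z)\,\mathrm{T}s_q\colon E_2\to\mathrm{T}E$, left side $\pi_1q\colon E_2\to M$, right side $\mathrm{T}q$ and bottom $z\colon M\to\mathrm{T}M$ is a $\mathrm{T}$-pullback. The tangent category is fully displayed if the projection of every differential bundle is a tangent display map. The Cauchy completion (Karoubi envelope) $\mathrm{Split}(\mathbb{X})$ has as objects the pairs $(M,e)$ with $e\colon M\to M$ idempotent, and as morphisms $(M,e)\to(M',e')$ the morphisms $f\colon M\to M'$ with $efe'=f$. Let $\iota\colon\mathbb{X}\to\mathrm{Split}(\mathbb{X})$, $M\mapsto(M,\mathrm{id}_M)$.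 Statement. Let $(\mathbb{X},\mathbb{T})$ be a well-displayed tangent category with negatives. Then the extensions $\bar{\mathrm{T}}(M,e)=(\mathrm{T}M,\mathrm{T}e)$, $\bar{\mathrm{T}}f=\mathrm{T}f$, $\bar{\mathrm{T}}_2(M,e)=(\mathrm{T}_2M,\mathrm{T}_2e)$, $\bar{\mathrm{T}}_2f=\mathrm{T}_2f$, together with the induced extensions of the pullback projections $\mathrm{T}_2\Rightarrow\mathrm{T}$ and of $p,z,+,l,c$, form a tangent structure on $\mathrm{Split}(\mathbb{X})$. The resulting tangent category $\mathrm{Split}(\mathbb{X},\mathbb{T})$ has negatives and is fully displayed, and $\iota$ is an embedding of $(\mathbb{X},\mathbb{T})$ into it: $\iota$ is fully faithful, injective on objects, strictly preserves the tangent structure, and preserves the finite pullback powers of the tangent bundles. -/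

import Mathlib

open CategoryTheory CategoryTheory.Limits

universe v u v' u'

namespace TangentCat

section Pullbacks

variable {C : Type u} [Category.{v} C]

/-- The iterates `T^n` of an endofunctor. -/
def iter (T : C ⥤ C) : ℕ → (C ⥤ C)
  | 0 => 𝟭 C
  | n + 1 => iter T n ⋙ T

/-- The square with projections `fst`, `snd` over the cospan `f`, `g` is a `T`-pullback: it is a
pullback and so is its image under every iterate `T^n` (the case `n = 0` is the square itself). -/
def IsTPullback (T : C ⥤ C) {P X Y Z : C} (fst : P ⟶ X) (snd : P ⟶ Y) (f : X ⟶ Z) (g : Y ⟶ Z) :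
    Prop :=
  ∀ n : ℕ, IsPullback ((iter T n).map fst) ((iter T n).map snd) ((iter T n).map f)
    ((iter T n).map g)

theorem IsTPullback.isPullback {T : C ⥤ C} {P X Y Z : C} {fst : P ⟶ X} {snd : P ⟶ Y} {f : X ⟶ Z}
    {g : Y ⟶ Z} (h : IsTPullback T fst snd f g) : IsPullback fst snd f g := h 0

theorem IsTPullback.map {T : C ⥤ C} {P X Y Z : C} {fst : P ⟶ X} {snd : P ⟶ Y} {f : X ⟶ Z}
    {g : Y ⟶ Z} (h : IsTPullback T fst snd f g) :
    IsPullback (T.map fst) (T.map snd) (T.map f) (T.map g) := h 1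

/-- All finite wide pullbacks of `q` along itself exist and are preserved by every `T^m`. -/
def HasTPowers (T : C ⥤ C) {E M : C} (q : E ⟶ M) : Prop :=
  ∀ n : ℕ, HasWidePullback M (fun _ : Fin n => E) (fun _ => q) ∧
    ∀ m : ℕ, PreservesLimit
      (WidePullbackShape.wideCospan M (fun _ : Fin n => E) (fun _ => q)) (iter T m)

/-- `q` is a display map: its pullback along every morphism into its codomain exists. -/
def IsDisplay {E M : C} (q : E ⟶ M) : Prop :=
  ∀ ⦃N : C⦄ (f : N ⟶ M), HasPullback f q

/-- `q` admits all `T`-pullbacks: it is a display map and all its pullbacks are `T`-pullbacks. -/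
def AdmitsTPullbacks (T : C ⥤ C) {E M : C} (q : E ⟶ M) : Prop :=
  IsDisplay q ∧ ∀ ⦃N P : C⦄ (f : N ⟶ M) (fst : P ⟶ N) (snd : P ⟶ E),
    IsPullback fst snd f q → IsTPullback T fst snd f q

/-- `q` is a `T`-display map: `T^n q` admits all `T`-pullbacks for every `n ≥ 0`. -/
def IsTDisplay (T : C ⥤ C) {E M : C} (q : E ⟶ M) : Prop :=
  ∀ n : ℕ, AdmitsTPullbacks T ((iter T n).map q)

end Pullbacks

section Additive

variable {C : Type u} [Category.{v} C]

/-- The data of an additive bundle: a projection `q : E ⟶ M`, a chosen pullback `E₂` of `q` along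
itself, a zero section candidate and an addition candidate. The laws are `IsAdditive`. -/
structure BundleData (E M : C) where
  proj : E ⟶ M
  E₂ : C
  π₁ : E₂ ⟶ E
  π₂ : E₂ ⟶ E
  isPullback : IsPullback π₁ π₂ proj proj
  zero : M ⟶ E
  add : E₂ ⟶ E

namespace BundleData

variable {E M : C}

/-- The sum of two generalized elements of `E` in the same fibre. -/
noncomputable def sum (B : BundleData E M) {W : C} (a b : W ⟶ E) (h : a ≫ B.proj = b ≫ B.proj) :
    W ⟶ E :=
  B.isPullback.lift a b h ≫ B.add

/-- The image of the data under a functor that preserves the chosen pullback. -/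
def map (B : BundleData E M) (F : C ⥤ C)
    (h : IsPullback (F.map B.π₁) (F.map B.π₂) (F.map B.proj) (F.map B.proj)) :
    BundleData (F.obj E) (F.obj M) where
  proj := F.map B.proj
  E₂ := F.obj B.E₂
  π₁ := F.map B.π₁
  π₂ := F.map B.π₂
  isPullback := h
  zero := F.map B.zero
  add := F.map B.add

/-- The laws of a commutative monoid in the slice over `M`. -/
structure IsAdditive (B : BundleData E M) : Prop where
  zero_proj : B.zero ≫ B.proj = 𝟙 M
  add_proj : B.add ≫ B.proj = B.π₁ ≫ B.proj
  sum_zero : ∀ {W : C} (a : W ⟶ E) (h : a ≫ B.proj = (a ≫ B.proj ≫ B.zero) ≫ B.proj),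
    B.sum a (a ≫ B.proj ≫ B.zero) h = a
  sum_comm : ∀ {W : C} (a b : W ⟶ E) (h : a ≫ B.proj = b ≫ B.proj),
    B.sum a b h = B.sum b a h.symm
  sum_assoc : ∀ {W : C} (a b c : W ⟶ E) (h₁ : a ≫ B.proj = b ≫ B.proj)
    (h₂ : B.sum a b h₁ ≫ B.proj = c ≫ B.proj) (h₃ : b ≫ B.proj = c ≫ B.proj)
    (h₄ : a ≫ B.proj = B.sum b c h₃ ≫ B.proj),
    B.sum (B.sum a b h₁) c h₂ = B.sum a (B.sum b c h₃) h₄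

/-- `(f, g)` is an additive bundle morphism from `B` to `B'`. -/
structure IsMorphism {E' M' : C} (B : BundleData E M) (B' : BundleData E' M')
    (f : E ⟶ E') (g : M ⟶ M') : Prop where
  comm : f ≫ B'.proj = B.proj ≫ g
  zero : B.zero ≫ f = g ≫ B'.zero
  add : B.add ≫ f = B'.sum (B.π₁ ≫ f) (B.π₂ ≫ f)
    (by rw [Category.assoc, Category.assoc, comm, ← Category.assoc, ← Category.assoc,
      B.isPullback.w])

end BundleData

end Additive

/-- The structure functors and natural transformations of a tangent structure: the tangent bundle
functor `T`, the functor `T₂` with its projections to `T`, the projection `p`, the zero section,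
the addition, the vertical lift `ℓ` and the canonical flip `c`. -/
structure TangentData (C : Type u) [Category.{v} C] where
  T : C ⥤ C
  T₂ : C ⥤ C
  p : T ⟶ 𝟭 C
  π₁ : T₂ ⟶ T
  π₂ : T₂ ⟶ T
  zero : 𝟭 C ⟶ T
  add : T₂ ⟶ T
  ℓ : T ⟶ T ⋙ T
  c : T ⋙ T ⟶ T ⋙ T

namespace TangentData

variable {C : Type u} [Category.{v} C]

/-- The tangent bundle `p : T M ⟶ M` with its zero section and addition. -/
def bundle (D : TangentData C) (M : C)
    (h : IsPullback (D.π₁.app M) (D.π₂.app M) (D.p.app M) (D.p.app M)) :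
    BundleData (D.T.obj M) M where
  proj := D.p.app M
  E₂ := D.T₂.obj M
  π₁ := D.π₁.app M
  π₂ := D.π₂.app M
  isPullback := h
  zero := D.zero.app M
  add := D.add.app M

/-- The extension of the structure to the Karoubi envelope: functors are extended by
`F (M, e) = (F M, F e)` and `F f = F f`, and natural transformations accordingly. -/
def split (D : TangentData C) : TangentData (Idempotents.Karoubi C) where
  T := (Idempotents.functorExtension₂ C C).obj D.T
  T₂ := (Idempotents.functorExtension₂ C C).obj D.T₂
  p := (Idempotents.functorExtension₂ C C).map D.p
  π₁ := (Idempotents.functorExtension₂ C C).map D.π₁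
  π₂ := (Idempotents.functorExtension₂ C C).map D.π₂
  zero := (Idempotents.functorExtension₂ C C).map D.zero
  add := (Idempotents.functorExtension₂ C C).map D.add
  ℓ := (Idempotents.functorExtension₂ C C).map D.ℓ
  c := (Idempotents.functorExtension₂ C C).map D.c

end TangentData

/-- A tangent structure on `C`; a tangent category is a category with a tangent structure. -/
structure TangentStructure (C : Type u) [Category.{v} C] extends TangentData C where
  /-- finite pullback powers of `p` exist and are preserved by all `T^m` -/
  powers : ∀ M : C, HasTPowers T (p.app M)
  /-- `T₂ M` is the pullback of `p` along itself, preserved by all `T^m` -/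
  isTPullback : ∀ M : C, IsTPullback T (π₁.app M) (π₂.app M) (p.app M) (p.app M)
  /-- `p : T M ⟶ M` is an additive bundle -/
  additive : ∀ M : C, (toTangentData.bundle M (isTPullback M).isPullback).IsAdditive
  /-- `(ℓ, 0) : (p, 0, +) ⟶ (T p, T 0, T +)` is an additive bundle morphism -/
  ℓ_additive : ∀ M : C,
    (toTangentData.bundle M (isTPullback M).isPullback).IsMorphism
      ((toTangentData.bundle M (isTPullback M).isPullback).map T (isTPullback M).map)
      (ℓ.app M) (zero.app M)
  /-- `(c, id) : (T p, T 0, T +) ⟶ (p, 0, +)` is an additive bundle morphism -/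
  c_additive : ∀ M : C,
    ((toTangentData.bundle M (isTPullback M).isPullback).map T (isTPullback M).map).IsMorphism
      (toTangentData.bundle (T.obj M) (isTPullback (T.obj M)).isPullback)
      (c.app M) (𝟙 (T.obj M))
  c_c : ∀ M : C, c.app M ≫ c.app M = 𝟙 (T.obj (T.obj M))
  ℓ_c : ∀ M : C, ℓ.app M ≫ c.app M = ℓ.app M
  ℓ_ℓ : ∀ M : C, ℓ.app M ≫ T.map (ℓ.app M) = ℓ.app M ≫ ℓ.app (T.obj M)
  c_c_c : ∀ M : C, T.map (c.app M) ≫ c.app (T.obj M) ≫ T.map (c.app M) =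
    c.app (T.obj M) ≫ T.map (c.app M) ≫ c.app (T.obj M)
  ℓ_c_c : ∀ M : C, ℓ.app (T.obj M) ≫ T.map (c.app M) ≫ c.app (T.obj M) =
    c.app M ≫ T.map (ℓ.app M)
  /-- universality of the vertical lift: the square with top `⟨π₁ ℓ, π₂ 0⟩ T(+) : T₂ M ⟶ T² M` and
  bottom `0 : M ⟶ T M` is a `T`-pullback -/
  universal : ∀ M : C, IsTPullback T
    (((toTangentData.bundle M (isTPullback M).isPullback).map T (isTPullback M).map).sum
      (π₁.app M ≫ ℓ.app M) (π₂.app M ≫ zero.app (T.obj M))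
      (((Category.assoc _ _ _).trans (congrArg (π₁.app M ≫ ·) (ℓ_additive M).comm)).trans
        (((Category.assoc _ _ _).symm.trans
          (congrArg (· ≫ zero.app M) (isTPullback M).isPullback.w)).trans
        ((Category.assoc _ _ _).trans ((congrArg (π₂.app M ≫ ·) (zero.naturality (p.app M))).trans
          (Category.assoc _ _ _).symm)))))
    (π₁.app M ≫ p.app M) (T.map (p.app M)) (zero.app M)

namespace TangentStructure

variable {C : Type u} [Category.{v} C]

/-- The tangent bundle of `M` as a bundle with zero section and addition. -/
def tangentBundle (𝕋 : TangentStructure C) (M : C) : BundleData (𝕋.T.obj M) M :=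
  𝕋.bundle M (𝕋.isTPullback M).isPullback

/-- The tangent category has negatives: there is a natural transformation `n : T ⟶ T` over `M` that
is an additive inverse for the fibrewise addition of every tangent bundle. -/
def HasNegatives (𝕋 : TangentStructure C) : Prop :=
  ∃ n : 𝕋.T ⟶ 𝕋.T, ∀ M : C, ∃ h : n.app M ≫ 𝕋.p.app M = 𝕋.p.app M,
    (𝕋.tangentBundle M).sum (𝟙 (𝕋.T.obj M)) (n.app M) ((Category.id_comp _).trans h.symm) =
      𝕋.p.app M ≫ 𝕋.zero.app M

/-- Well-displayed: every tangent bundle `p : T M ⟶ M` is a tangent display map. -/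
def WellDisplayed (𝕋 : TangentStructure C) : Prop :=
  ∀ M : C, IsTDisplay 𝕋.T (𝕋.p.app M)

/-- A differential bundle with total object `E` and base `M`. -/
structure DifferentialBundle (𝕋 : TangentStructure C) (E M : C) extends BundleData E M where
  powers : HasTPowers 𝕋.T proj
  isTPullback : IsTPullback 𝕋.T π₁ π₂ proj proj
  additive : toBundleData.IsAdditive
  /-- the vertical lift -/
  vlift : E ⟶ 𝕋.T.obj E
  vlift_map : toBundleData.IsMorphism (toBundleData.map 𝕋.T isTPullback.map) vlift (𝕋.zero.app M)
  vlift_tangent : toBundleData.IsMorphism (𝕋.tangentBundle E) vlift zero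
  /-- universality: the square with top `⟨π₁ vlift, π₂ 0⟩ T(add) : E₂ ⟶ T E` and bottom
  `0 : M ⟶ T M` is a `T`-pullback -/
  universal : IsTPullback 𝕋.T
    ((toBundleData.map 𝕋.T isTPullback.map).sum (π₁ ≫ vlift) (π₂ ≫ 𝕋.zero.app E)
      (((Category.assoc _ _ _).trans (congrArg (π₁ ≫ ·) vlift_map.comm)).trans
        (((Category.assoc _ _ _).symm.trans
          (congrArg (· ≫ 𝕋.zero.app M) isTPullback.isPullback.w)).trans
        ((Category.assoc _ _ _).trans ((congrArg (π₂ ≫ ·) (𝕋.zero.naturality proj)).trans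
          (Category.assoc _ _ _).symm)))))
    (π₁ ≫ proj) (𝕋.T.map proj) (𝕋.zero.app M)
  vlift_vlift : vlift ≫ 𝕋.ℓ.app E = vlift ≫ 𝕋.T.map vlift

/-- Fully displayed: the projection of every differential bundle is a tangent display map. -/
def FullyDisplayed (𝕋 : TangentStructure C) : Prop :=
  ∀ {E M : C} (B : 𝕋.DifferentialBundle E M), IsTDisplay 𝕋.T B.proj

end TangentStructure

/-- `F` embeds the tangent category `(C, 𝕋)` into `(D, 𝕊)`: it is fully faithful, injective on
objects, and preserves the tangent structures strictly, that is, up to equality. -/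
structure IsStrictEmbedding {C : Type u} [Category.{v} C] {D : Type u'} [Category.{v'} D]
    (𝕋 : TangentStructure C) (𝕊 : TangentStructure D) (F : C ⥤ D) : Prop where
  full : F.Full
  faithful : F.Faithful
  obj_injective : Function.Injective F.obj
  map_T : 𝕋.T ⋙ F = F ⋙ 𝕊.T
  map_T₂ : 𝕋.T₂ ⋙ F = F ⋙ 𝕊.T₂
  map_p : ∀ M : C, F.map (𝕋.p.app M) ≍ 𝕊.p.app (F.obj M)
  map_π₁ : ∀ M : C, F.map (𝕋.π₁.app M) ≍ 𝕊.π₁.app (F.obj M)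
  map_π₂ : ∀ M : C, F.map (𝕋.π₂.app M) ≍ 𝕊.π₂.app (F.obj M)
  map_zero : ∀ M : C, F.map (𝕋.zero.app M) ≍ 𝕊.zero.app (F.obj M)
  map_add : ∀ M : C, F.map (𝕋.add.app M) ≍ 𝕊.add.app (F.obj M)
  map_ℓ : ∀ M : C, F.map (𝕋.ℓ.app M) ≍ 𝕊.ℓ.app (F.obj M)
  map_c : ∀ M : C, F.map (𝕋.c.app M) ≍ 𝕊.c.app (F.obj M)
  /-- `F` preserves the finite pullback powers of the tangent bundles -/
  map_powers : ∀ (M : C) (n : ℕ), PreservesLimit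
    (WidePullbackShape.wideCospan M (fun _ : Fin n => 𝕋.T.obj M) (fun _ => 𝕋.p.app M)) F

end TangentCat

/-! Every structure map of the envelope is a structure map of `C` precomposed with an idempotent, so
equational axioms transfer from `C` by naturality (`IsInduced.eq`). Pullbacks transfer because a
square compatible with the idempotents has its lifts in the envelope (`isPullback_karoubi`). Finite
powers and display maps transfer because the relevant cospan is a retract of one coming from `C`,
and in an idempotent complete category a retract of a diagram with a limit has a limit, preserved by
the same functors.

Full display is then a fact about any idempotent complete, well-displayed tangent category with
negatives (`fullyDisplayed`). Given a differential bundle q : E → M with zero section z and lift l,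
let P be the pullback of TE → E along z; P → M is a tangent display map by base change. The lift
gives i = ⟨q, l⟩ : E → P. Conversely, a tangent vector v at a zero point has the vertical part v −
T(qz)v, which T(q) sends to zero, so universality of the lift turns it into a point of E. This
retracts P onto E over M, and tangent display maps are closed under retracts over the base
(`IsTDisplay.of_retract`). -/

namespace TangentCat

/-! ### Retracts of limit cones and of diagrams. -/

section Retracts

variable {C : Type u} [Category.{v} C]

/-- A retract of a pullback square is a pullback square. -/
theorem isPullback_of_retract {P X Y Z P' X' Y' Z' : C}
    {fst : P ⟶ X} {snd : P ⟶ Y} {f : X ⟶ Z} {g : Y ⟶ Z}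
    {fst' : P' ⟶ X'} {snd' : P' ⟶ Y'} {f' : X' ⟶ Z'} {g' : Y' ⟶ Z'}
    (h : IsPullback fst snd f g)
    {iP : P' ⟶ P} {rP : P ⟶ P'} {iX : X' ⟶ X} {rX : X ⟶ X'} {iY : Y' ⟶ Y} {rY : Y ⟶ Y'}
    {iZ : Z' ⟶ Z} {rZ : Z ⟶ Z'}
    (hP : iP ≫ rP = 𝟙 P') (hX : iX ≫ rX = 𝟙 X') (hY : iY ≫ rY = 𝟙 Y') (hZ : iZ ≫ rZ = 𝟙 Z')
    (i_fst : iP ≫ fst = fst' ≫ iX) (i_snd : iP ≫ snd = snd' ≫ iY)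
    (r_fst : rP ≫ fst' = fst ≫ rX) (r_snd : rP ≫ snd' = snd ≫ rY)
    (i_f : iX ≫ f = f' ≫ iZ) (i_g : iY ≫ g = g' ≫ iZ) :
    IsPullback fst' snd' f' g' := by
  -- At the corner `Z'` only split monicity of `iZ` matters, so `rZ` need not commute with `f` and
  -- `g`.
  have cancel : ∀ {W : C} (a b : W ⟶ Z'), a ≫ iZ = b ≫ iZ → a = b := fun a b e => by
    simpa [hZ] using congrArg (· ≫ rZ) e
  have w : fst' ≫ f' = snd' ≫ g' := cancel _ _ (by
    rw [Category.assoc, Category.assoc, ← i_f, ← i_g, ← Category.assoc, ← Category.assoc,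
      ← i_fst, ← i_snd, Category.assoc, Category.assoc, h.w])
  refine ⟨⟨w⟩, ⟨PullbackCone.IsLimit.mk w
    (fun s => h.lift (s.fst ≫ iX) (s.snd ≫ iY) ?_ ≫ rP) ?_ ?_ ?_⟩⟩
  · rw [Category.assoc, Category.assoc, i_f, i_g, s.condition_assoc]
  · intro s
    rw [Category.assoc, r_fst, h.lift_fst_assoc, Category.assoc, hX, Category.comp_id]
  · intro s
    rw [Category.assoc, r_snd, h.lift_snd_assoc, Category.assoc, hY, Category.comp_id]
  · intro s m m₁ m₂
    have : m ≫ iP = h.lift (s.fst ≫ iX) (s.snd ≫ iY)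
        (by rw [Category.assoc, Category.assoc, i_f, i_g, s.condition_assoc]) := by
      apply h.hom_ext
      · rw [h.lift_fst, Category.assoc, i_fst, ← m₁, Category.assoc]
      · rw [h.lift_snd, Category.assoc, i_snd, ← m₂, Category.assoc]
    rw [← this, Category.assoc, hP, Category.comp_id]

variable {J : Type u'} [Category.{v'} J]

/-- A cone that is a retract of a limit cone, over a retract of diagrams, is a limit cone. -/
noncomputable def isLimitOfRetract {K K' : J ⥤ C} {i : K' ⟶ K} {r : K ⟶ K'} (hir : i ≫ r = 𝟙 K')
    {c : Cone K} (hc : IsLimit c) {c' : Cone K'} (ic : c'.pt ⟶ c.pt) (rc : c.pt ⟶ c'.pt)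
    (hc' : ic ≫ rc = 𝟙 c'.pt) (hi : ∀ j, ic ≫ c.π.app j = c'.π.app j ≫ i.app j)
    (hr : ∀ j, rc ≫ c'.π.app j = c.π.app j ≫ r.app j) : IsLimit c' where
  lift s := hc.lift ((Cone.postcompose i).obj s) ≫ rc
  fac s j := by
    have : i.app j ≫ r.app j = 𝟙 _ := by rw [← NatTrans.comp_app, hir, NatTrans.id_app]
    rw [Category.assoc, hr, hc.fac_assoc]
    simp [this]
  uniq s m hm := by
    have : m ≫ ic = hc.lift ((Cone.postcompose i).obj s) := by
      apply hc.hom_ext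
      intro j
      rw [hc.fac, Category.assoc, hi, ← Category.assoc, hm]
      rfl
    rw [← this, Category.assoc, hc', Category.comp_id]

/-- In an idempotent complete category a retract of a diagram with a limit has a limit. -/
theorem hasLimit_of_retract [IsIdempotentComplete C] {K K' : J ⥤ C} {i : K' ⟶ K} {r : K ⟶ K'}
    (hir : i ≫ r = 𝟙 K') [HasLimit K] : HasLimit K' := by
  have hir' : ∀ j, i.app j ≫ r.app j = 𝟙 _ := fun j => by
    rw [← NatTrans.comp_app, hir, NatTrans.id_app]
  -- The idempotent `r ≫ i` of the diagram acts on `limit K`; the object splitting that action is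
  -- the limit of `K'`.
  have idem : limMap (r ≫ i) ≫ limMap (r ≫ i) = limMap (r ≫ i) := by
    apply limit.hom_ext
    intro j
    simp [reassoc_of% hir']
  obtain ⟨Q, ic, rc, h₁, h₂⟩ := IsIdempotentComplete.idempotents_split _ _ idem
  have hic : ic ≫ limMap (r ≫ i) = ic := by rw [← h₂, reassoc_of% h₁]
  refine ⟨⟨⟨(Cone.postcompose r).obj ((limit.cone K).extend ic),
    isLimitOfRetract hir (limit.isLimit K) ic rc h₁ (fun j => ?_) (fun j => ?_)⟩⟩⟩
  · have : ic ≫ limMap (r ≫ i) ≫ limit.π K j = ic ≫ limit.π K j := by rw [reassoc_of% hic]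
    rw [limMap_π] at this
    simpa using this.symm
  · have : limMap (r ≫ i) ≫ limit.π K j ≫ r.app j = limit.π K j ≫ r.app j := by
      rw [limMap_π_assoc]
      simp [hir']
    rw [← h₂] at this
    simpa using this

/-- A functor preserving a limit preserves the limits of the retracts of the diagram. -/
theorem preservesLimit_of_retract {D : Type*} [Category* D] {K K' : J ⥤ C} {i : K' ⟶ K}
    {r : K ⟶ K'} (hir : i ≫ r = 𝟙 K') [HasLimit K] (F : C ⥤ D) [PreservesLimit K F] :
    PreservesLimit K' F := by
  have hir' : ∀ j, i.app j ≫ r.app j = 𝟙 _ := fun j => by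
    rw [← NatTrans.comp_app, hir, NatTrans.id_app]
  refine ⟨fun {c'} hc' => ?_⟩
  have hc := limit.isLimit K
  let ic : c'.pt ⟶ limit K := limit.lift K ((Cone.postcompose i).obj c')
  let rc : limit K ⟶ c'.pt := hc'.lift ((Cone.postcompose r).obj (limit.cone K))
  have hi : ∀ j, ic ≫ limit.π K j = c'.π.app j ≫ i.app j := fun j => by simp [ic]
  have hr : ∀ j, rc ≫ c'.π.app j = limit.π K j ≫ r.app j := fun j => by simp [rc]
  have hc'' : ic ≫ rc = 𝟙 _ := by
    apply hc'.hom_ext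
    intro j
    rw [Category.assoc, hr, reassoc_of% hi, hir', Category.comp_id, Category.id_comp]
  refine ⟨isLimitOfRetract (i := Functor.whiskerRight i F) (r := Functor.whiskerRight r F) ?_
    (isLimitOfPreserves F hc) (F.map ic) (F.map rc) ?_ (fun j => ?_) (fun j => ?_)⟩
  · rw [← Functor.whiskerRight_comp, hir, Functor.whiskerRight_id']
  · exact (F.map_comp _ _).symm.trans ((congrArg F.map hc'').trans (F.map_id _))
  · exact (F.map_comp _ _).symm.trans ((congrArg F.map (hi j)).trans (F.map_comp _ _))
  · exact (F.map_comp _ _).symm.trans ((congrArg F.map (hr j)).trans (F.map_comp _ _))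

end Retracts

/-! ### Tangent display maps: base change and retracts. -/

section Display

variable {C : Type u} [Category.{v} C] {T : C ⥤ C}

theorem iter_add (T : C ⥤ C) (m n : ℕ) : iter T (m + n) = iter T m ⋙ iter T n := by
  induction n with
  | zero => rfl
  | succ n ih => exact congrArg (· ⋙ T) ih

/-- `iter T (m + n)` and `iter T m ⋙ iter T n` have the same pullback squares. -/
theorem isPullback_iter_add {P X Y Z : C} {fst : P ⟶ X} {snd : P ⟶ Y}
    {f : X ⟶ Z} {g : Y ⟶ Z} {m n : ℕ}
    (h : IsPullback ((iter T (m + n)).map fst) ((iter T (m + n)).map snd)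
      ((iter T (m + n)).map f) ((iter T (m + n)).map g)) :
    IsPullback ((iter T n).map ((iter T m).map fst)) ((iter T n).map ((iter T m).map snd))
      ((iter T n).map ((iter T m).map f)) ((iter T n).map ((iter T m).map g)) := by
  rw [iter_add] at h
  exact h

theorem IsTPullback.map_iter {P X Y Z : C} {fst : P ⟶ X} {snd : P ⟶ Y} {f : X ⟶ Z}
    {g : Y ⟶ Z} (h : IsTPullback T fst snd f g) (m : ℕ) :
    IsTPullback T ((iter T m).map fst) ((iter T m).map snd) ((iter T m).map f)
      ((iter T m).map g) :=
  fun n => isPullback_iter_add (h (m + n))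

/-- A pullback square isomorphic to a `T`-pullback is a `T`-pullback. -/
theorem IsTPullback.of_isPullback {P P' X Y Z : C} {fst : P ⟶ X} {snd : P ⟶ Y} {f : X ⟶ Z}
    {g : Y ⟶ Z} (h : IsTPullback T fst snd f g) {fst' : P' ⟶ X} {snd' : P' ⟶ Y}
    (h' : IsPullback fst' snd' f g) : IsTPullback T fst' snd' f g := fun n =>
  (h n).of_iso ((iter T n).mapIso (h.isPullback.isoIsPullback _ _ h')) (Iso.refl _) (Iso.refl _)
    (Iso.refl _) (by simp [← Functor.map_comp]) (by simp [← Functor.map_comp]) (by simp) (by simp)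

/-- There is a `T`-pullback of the cospan `f`, `g`. -/
def ExistsTPullback (T : C ⥤ C) {X Y Z : C} (f : X ⟶ Z) (g : Y ⟶ Z) : Prop :=
  ∃ (P : C) (fst : P ⟶ X) (snd : P ⟶ Y), IsTPullback T fst snd f g

/-- Pullbacks of a cospan are unique up to isomorphism, so one `T`-pullback forces all of them to be
`T`-pullbacks. Closure properties then only require constructing one square. -/
theorem isTDisplay_iff {E M : C} {q : E ⟶ M} :
    IsTDisplay T q ↔
      ∀ (n : ℕ) {N : C} (f : N ⟶ (iter T n).obj M), ExistsTPullback T f ((iter T n).map q) := by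
  constructor
  · intro h n N f
    have := (h n).1 f
    exact ⟨_, _, _, (h n).2 f _ _ (IsPullback.of_hasPullback f _)⟩
  · intro h n
    refine ⟨fun N f => ?_, fun N P f fst snd sq => ?_⟩
    · obtain ⟨P, fst, snd, sq⟩ := h n f
      exact sq.isPullback.hasPullback
    · obtain ⟨_, _, _, sq'⟩ := h n f
      exact sq'.of_isPullback sq

/-- Tangent display maps are stable under base change. -/
theorem IsTDisplay.of_isPullback {E M E' M' : C} {q : E ⟶ M} (h : IsTDisplay T q)
    {f : M' ⟶ M} {q' : E' ⟶ M'} {g : E' ⟶ E} (sq : IsPullback q' g f q) : IsTDisplay T q' := by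
  have hsq : IsTPullback T q' g f q := (h 0).2 f _ _ sq
  rw [isTDisplay_iff] at h ⊢
  intro n N k
  -- Pasting: the pullback of `T^n q` along `k ≫ T^n f`, factored through the square `T^n sq`, is
  -- the pullback of `T^n q'` along `k`.
  obtain ⟨P, fst, snd, hP⟩ := h n (k ≫ (iter T n).map f)
  have hn := hsq.map_iter n
  have w : (fst ≫ k) ≫ (iter T n).map f = snd ≫ (iter T n).map q := by
    rw [Category.assoc, hP.isPullback.w]
  refine ⟨P, fst, hn.isPullback.lift (fst ≫ k) snd w, fun m => ?_⟩
  refine IsPullback.of_bot (v₂₁ := (iter T m).map ((iter T n).map g))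
    (v₂₂ := (iter T m).map ((iter T n).map f)) ?_ ?_ (hn m)
  · simp only [← Functor.map_comp]
    rw [hn.isPullback.lift_snd]
    exact hP m
  · simp only [← Functor.map_comp]
    rw [hn.isPullback.lift_fst]

/-- In an idempotent complete category, a retract of a cospan that has a `T`-pullback has a
`T`-pullback. -/
theorem ExistsTPullback.of_retract [IsIdempotentComplete C] {X Y Z X' Y' Z' : C}
    {f : X ⟶ Z} {g : Y ⟶ Z} {f' : X' ⟶ Z'} {g' : Y' ⟶ Z'} (h : ExistsTPullback T f g)
    {iX : X' ⟶ X} {rX : X ⟶ X'} {iY : Y' ⟶ Y} {rY : Y ⟶ Y'} {iZ : Z' ⟶ Z} {rZ : Z ⟶ Z'}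
    (hX : iX ≫ rX = 𝟙 X') (hY : iY ≫ rY = 𝟙 Y') (hZ : iZ ≫ rZ = 𝟙 Z')
    (i_f : iX ≫ f = f' ≫ iZ) (i_g : iY ≫ g = g' ≫ iZ)
    (r_f : rX ≫ f' = f ≫ rZ) (r_g : rY ≫ g' = g ≫ rZ) : ExistsTPullback T f' g' := by
  obtain ⟨P, fst, snd, sq⟩ := h
  have sq₀ := sq.isPullback
  -- The idempotent of the cospan induces one on its pullback, and its splitting is the new apex.
  -- Retracts survive any functor, so the same data serve for every iterate.
  let ε : P ⟶ P := sq₀.lift (fst ≫ rX ≫ iX) (snd ≫ rY ≫ iY) (by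
    simp only [Category.assoc, i_f, i_g]
    rw [reassoc_of% r_f, reassoc_of% r_g, sq₀.w_assoc])
  have ε₁ : ε ≫ fst = fst ≫ rX ≫ iX := sq₀.lift_fst _ _ _
  have ε₂ : ε ≫ snd = snd ≫ rY ≫ iY := sq₀.lift_snd _ _ _
  have idem : ε ≫ ε = ε := by
    apply sq₀.hom_ext
    · rw [Category.assoc, ε₁, reassoc_of% ε₁, reassoc_of% hX]
    · rw [Category.assoc, ε₂, reassoc_of% ε₂, reassoc_of% hY]
  obtain ⟨Q, iP, rP, hP, hε⟩ := IsIdempotentComplete.idempotents_split _ _ idem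
  have hiε : iP ≫ ε = iP := by rw [← hε, reassoc_of% hP]
  refine ⟨Q, iP ≫ fst ≫ rX, iP ≫ snd ≫ rY, fun n => ?_⟩
  refine isPullback_of_retract (sq n)
    (iP := (iter T n).map iP) (rP := (iter T n).map rP) (iX := (iter T n).map iX)
    (rX := (iter T n).map rX) (iY := (iter T n).map iY) (rY := (iter T n).map rY)
    (iZ := (iter T n).map iZ) (rZ := (iter T n).map rZ) ?_ ?_ ?_ ?_ ?_ ?_ ?_ ?_ ?_ ?_
  all_goals rw [← Functor.map_comp]
  any_goals rw [← Functor.map_comp]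
  · exact (congrArg (iter T n).map hP).trans ((iter T n).map_id _)
  · exact (congrArg (iter T n).map hX).trans ((iter T n).map_id _)
  · exact (congrArg (iter T n).map hY).trans ((iter T n).map_id _)
  · exact (congrArg (iter T n).map hZ).trans ((iter T n).map_id _)
  all_goals refine congrArg (iter T n).map ?_
  · rw [Category.assoc, Category.assoc, ← ε₁, reassoc_of% hiε]
  · rw [Category.assoc, Category.assoc, ← ε₂, reassoc_of% hiε]
  · rw [reassoc_of% hε, reassoc_of% ε₁, hX, Category.comp_id]
  · rw [reassoc_of% hε, reassoc_of% ε₂, hY, Category.comp_id]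
  · exact i_f
  · exact i_g

/-- In an idempotent complete category tangent display maps are stable under retracts over the
base. -/
theorem IsTDisplay.of_retract [IsIdempotentComplete C] {E E' M : C} {q : E ⟶ M} {q' : E' ⟶ M}
    (h : IsTDisplay T q) {i : E' ⟶ E} {r : E ⟶ E'} (hir : i ≫ r = 𝟙 E') (hi : i ≫ q = q')
    (hr : r ≫ q' = q) : IsTDisplay T q' := by
  rw [isTDisplay_iff] at h ⊢
  intro n N f
  refine (h n f).of_retract (iX := 𝟙 _) (rX := 𝟙 _) (iZ := 𝟙 _) (rZ := 𝟙 _)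
    (iY := (iter T n).map i) (rY := (iter T n).map r) ?_ ?_ ?_ ?_ ?_ ?_ ?_
  all_goals simp [← Functor.map_comp, hir, hi, hr]

end Display

/-! ### Calculus of fibrewise sums. -/

namespace BundleData

variable {C : Type u} [Category.{v} C] {E M : C}

theorem sum_congr (B : BundleData E M) {W : C} {a a' b b' : W ⟶ E} (h : a ≫ B.proj = b ≫ B.proj)
    (ha : a = a') (hb : b = b') :
    B.sum a b h = B.sum a' b' (by rw [← ha, ← hb, h]) := by
  subst ha hb; rfl

/-- The sum in terms of any factorization through the chosen pullback. -/
theorem sum_eq (B : BundleData E M) {W : C} {a b : W ⟶ E} (h : a ≫ B.proj = b ≫ B.proj)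
    (k : W ⟶ B.E₂) (h₁ : k ≫ B.π₁ = a) (h₂ : k ≫ B.π₂ = b) : B.sum a b h = k ≫ B.add := by
  unfold sum
  congr 1
  apply B.isPullback.hom_ext <;> simp [h₁, h₂]

theorem comp_sum (B : BundleData E M) {V W : C} (x : V ⟶ W) {a b : W ⟶ E}
    (h : a ≫ B.proj = b ≫ B.proj) :
    x ≫ B.sum a b h = B.sum (x ≫ a) (x ≫ b) (by rw [Category.assoc, h, Category.assoc]) := by
  unfold sum
  rw [← Category.assoc]
  congr 1
  apply B.isPullback.hom_ext <;> simp

theorem sum_comp {E' M' : C} {B : BundleData E M} {B' : BundleData E' M'} {f : E ⟶ E'}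
    {g : M ⟶ M'} (hf : B.IsMorphism B' f g) {W : C} {a b : W ⟶ E}
    (h : a ≫ B.proj = b ≫ B.proj) :
    B.sum a b h ≫ f = B'.sum (a ≫ f) (b ≫ f)
      (by rw [Category.assoc, Category.assoc, hf.comm, reassoc_of% h]) := by
  unfold sum
  rw [Category.assoc, hf.add, comp_sum]
  exact sum_congr _ _ (by simp) (by simp)

theorem IsAdditive.sum_proj_zero {B : BundleData E M} (hB : B.IsAdditive) {W : C} (a b : W ⟶ E)
    (hb : b = a ≫ B.proj ≫ B.zero) (h : a ≫ B.proj = b ≫ B.proj) : B.sum a b h = a := by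
  subst hb
  exact hB.sum_zero a h

/-- A functor that preserves the chosen pullback preserves sums. -/
theorem map_sum (B : BundleData E M) (F : C ⥤ C)
    (hF : IsPullback (F.map B.π₁) (F.map B.π₂) (F.map B.proj) (F.map B.proj)) {W : C}
    {a b : W ⟶ E} (h : a ≫ B.proj = b ≫ B.proj)
    (h' : F.map a ≫ (B.map F hF).proj = F.map b ≫ (B.map F hF).proj) :
    (B.map F hF).sum (F.map a) (F.map b) h' = F.map (B.sum a b h) := by
  refine ((B.map F hF).sum_eq h' (F.map (B.isPullback.lift a b h)) ?_ ?_).trans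
    (F.map_comp _ _).symm
  · exact (F.map_comp _ _).symm.trans (congrArg F.map (B.isPullback.lift_fst _ _ _))
  · exact (F.map_comp _ _).symm.trans (congrArg F.map (B.isPullback.lift_snd _ _ _))

end BundleData

/-! ### Differential bundles as retracts of pulled-back tangent bundles. -/

namespace TangentStructure

variable {C : Type u} [Category.{v} C] (𝕋 : TangentStructure C)

/-- Naturality of the tangent bundle: `(T f, f)` is an additive bundle morphism. -/
theorem isMorphism_map {E M : C} (f : E ⟶ M) :
    (𝕋.tangentBundle E).IsMorphism (𝕋.tangentBundle M) (𝕋.T.map f) f where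
  comm := 𝕋.p.naturality f
  zero := (𝕋.zero.naturality f).symm
  add := (𝕋.add.naturality f).symm.trans
    ((𝕋.tangentBundle M).sum_eq _ (𝕋.T₂.map f) (𝕋.π₁.naturality f) (𝕋.π₂.naturality f)).symm

/-- Evaluating v + n(v) = 0 at the zero section gives 0 + n(0) = 0, and 0 is the unit. -/
theorem zero_neg {n : 𝕋.T ⟶ 𝕋.T} (hn : ∀ M : C, ∃ h : n.app M ≫ 𝕋.p.app M = 𝕋.p.app M,
    (𝕋.tangentBundle M).sum (𝟙 (𝕋.T.obj M)) (n.app M) ((Category.id_comp _).trans h.symm) =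
      𝕋.p.app M ≫ 𝕋.zero.app M) (M : C) : 𝕋.zero.app M ≫ n.app M = 𝕋.zero.app M := by
  obtain ⟨h, e⟩ := hn M
  have add : (𝕋.tangentBundle M).IsAdditive := 𝕋.additive M
  change n.app M ≫ (𝕋.tangentBundle M).proj = (𝕋.tangentBundle M).proj at h
  change _ = (𝕋.tangentBundle M).proj ≫ (𝕋.tangentBundle M).zero at e
  change (𝕋.tangentBundle M).zero ≫ n.app M = (𝕋.tangentBundle M).zero
  have e' := congrArg ((𝕋.tangentBundle M).zero ≫ ·) e
  simp only [BundleData.comp_sum, reassoc_of% add.zero_proj] at e'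
  rw [add.sum_comm, add.sum_proj_zero] at e'
  · exact e'
  · rw [Category.assoc, reassoc_of% h, reassoc_of% add.zero_proj, Category.comp_id]

/-- In an idempotent complete, well-displayed tangent category with negatives the projection of
every differential bundle is a tangent display map. -/
theorem fullyDisplayed [IsIdempotentComplete C] (hneg : 𝕋.HasNegatives)
    (hdisp : 𝕋.WellDisplayed) : 𝕋.FullyDisplayed := by
  intro E M B
  obtain ⟨n, hn⟩ := hneg
  let TE := 𝕋.tangentBundle E
  let TM := 𝕋.tangentBundle M
  have hTE : TE.IsAdditive := 𝕋.additive E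
  have hnE : n.app E ≫ TE.proj = TE.proj := (hn E).1
  have hzn : TE.zero ≫ n.app E = TE.zero := 𝕋.zero_neg hn E
  have hzq : B.zero ≫ B.proj = 𝟙 M := B.additive.zero_proj
  have hlp : B.vlift ≫ TE.proj = B.proj ≫ B.zero := B.vlift_tangent.comm
  have hlq : B.vlift ≫ 𝕋.T.map B.proj = B.proj ≫ TM.zero := B.vlift_map.comm
  have hz : TM.zero ≫ 𝕋.T.map B.zero = B.zero ≫ TE.zero := (𝕋.zero.naturality B.zero).symm
  have hpq : 𝕋.T.map B.proj ≫ TM.proj = TE.proj ≫ B.proj := 𝕋.p.naturality B.proj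
  have hpz : 𝕋.T.map B.zero ≫ TE.proj = TM.proj ≫ B.zero := 𝕋.p.naturality B.zero
  have hn_q : n.app E ≫ 𝕋.T.map B.proj = 𝕋.T.map B.proj ≫ n.app M := (n.naturality _).symm
  have hTzq : 𝕋.T.map B.zero ≫ 𝕋.T.map B.proj = 𝟙 _ := by
    rw [← Functor.map_comp, hzq, CategoryTheory.Functor.map_id]
  have hTEdisp : IsTDisplay 𝕋.T TE.proj := hdisp E
  -- `P` is the tangent bundle of `E` restricted to the zero section of `B`.
  obtain ⟨P, q', g, sq⟩ : ∃ (P : C) (q' : P ⟶ M) (g : P ⟶ 𝕋.T.obj E),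
      IsPullback q' g B.zero TE.proj := by
    obtain ⟨P, q', g, hP⟩ := isTDisplay_iff.1 hTEdisp 0 B.zero
    exact ⟨P, q', g, hP.isPullback⟩
  -- the vertical part `g - T(q z) g` of `g`
  have hw : g ≫ TE.proj = (g ≫ 𝕋.T.map B.proj ≫ 𝕋.T.map B.zero ≫ n.app E) ≫ TE.proj := by
    simp only [Category.assoc, hnE, hpz, reassoc_of% hpq]
    rw [← sq.w_assoc, reassoc_of% hzq, sq.w]
  let w : P ⟶ 𝕋.T.obj E := TE.sum g (g ≫ 𝕋.T.map B.proj ≫ 𝕋.T.map B.zero ≫ n.app E) hw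
  -- `T q` is additive, commutes with `n`, and has `T z` as a section, so it sends `w` to x − x = 0
  -- with x = `g ≫ T q`.
  have w_q : w ≫ 𝕋.T.map B.proj = q' ≫ TM.zero := by
    have e : TM.sum (𝟙 _) (n.app M) _ = TM.proj ≫ TM.zero := (hn M).2
    have e' := congrArg (g ≫ 𝕋.T.map B.proj ≫ ·) e
    simp only [BundleData.comp_sum] at e'
    rw [reassoc_of% hpq, ← sq.w_assoc, reassoc_of% hzq] at e'
    rw [← e', BundleData.sum_comp (𝕋.isMorphism_map B.proj)]
    refine BundleData.sum_congr _ _ ?_ ?_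
    · rw [Category.comp_id]
    · simp only [Category.assoc, hn_q]
      rw [reassoc_of% hTzq]
  have univ := B.universal.isPullback
  let k : P ⟶ B.E₂ := univ.lift w q' w_q
  let r : P ⟶ E := k ≫ B.π₁
  have hr : r ≫ B.proj = q' := (Category.assoc _ _ _).trans (univ.lift_snd w q' w_q)
  let i : E ⟶ P := sq.lift B.proj B.vlift hlp.symm
  have i_q : i ≫ q' = B.proj := sq.lift_fst _ _ _
  have i_g : i ≫ g = B.vlift := sq.lift_snd _ _ _
  refine (hTEdisp.of_isPullback sq).of_retract (i := i) (r := r) ?_ i_q hr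
  -- The identity `i ≫ r = 𝟙` is checked one level up: maps into `E₂` are detected by the
  -- universality square, where `i ≫ k` and `j` both have first component `B.vlift`.
  let j : E ⟶ B.E₂ := B.isPullback.lift (𝟙 E) (B.proj ≫ B.zero) (by simp [hzq])
  have j₁ : j ≫ B.π₁ = 𝟙 E := B.isPullback.lift_fst _ _ _
  have j₂ : j ≫ B.π₂ = B.proj ≫ B.zero := B.isPullback.lift_snd _ _ _
  suffices h : i ≫ k = j by
    rw [← Category.assoc, h, j₁]
  have k₁ : k ≫ _ = w := univ.lift_fst w q' w_q
  have k₂ : k ≫ B.π₁ ≫ B.proj = q' := univ.lift_snd w q' w_q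
  apply univ.hom_ext
  · rw [Category.assoc, k₁, BundleData.comp_sum]
    -- `T` applied to a + 0 = a; precomposing with the lift evaluates the top side of the
    -- universality square at `j`.
    have hj := B.toBundleData.map_sum 𝕋.T B.isTPullback.map (a := 𝟙 E) (b := B.proj ≫ B.zero)
      (by simp [hzq]) (by
        change 𝕋.T.map _ ≫ 𝕋.T.map _ = 𝕋.T.map _ ≫ 𝕋.T.map _
        simp [← Functor.map_comp, hzq])
    rw [B.additive.sum_proj_zero _ _ (Category.id_comp _).symm] at hj
    have hj' := congrArg (B.vlift ≫ ·) hj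
    simp only [BundleData.comp_sum] at hj'
    refine Eq.trans (b := B.vlift) ?_ (Eq.trans ?_ (hj'.symm.trans ?_))
    -- A lifted vector is already vertical: the term subtracted from it is −0 = 0, by `hlq` and
    -- `hzn`.
    · refine (BundleData.sum_congr _ _ i_g rfl).trans ?_
      refine hTE.sum_proj_zero _ _ ?_ _
      rw [reassoc_of% i_g, reassoc_of% hlq, reassoc_of% hz, hzn, reassoc_of% hlp]
    · rw [CategoryTheory.Functor.map_id, Category.comp_id]
    · refine (BundleData.sum_congr _ _ ?_ ?_).trans (BundleData.comp_sum _ _ _).symm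
      · rw [reassoc_of% j₁, CategoryTheory.Functor.map_id, Category.comp_id]
      · refine Eq.trans ?_ ((j₂ =≫ TE.zero).symm.trans (Category.assoc _ _ _))
        rw [Functor.map_comp, reassoc_of% hlq, hz, Category.assoc]
  · rw [Category.assoc, k₂, reassoc_of% j₁, i_q]

end TangentStructure

open Idempotents

/-! ### Limits and display maps in the Karoubi envelope. -/

section Karoubi

variable {C : Type u} [Category.{v} C]

/-- The extension of an endofunctor to the Karoubi envelope. -/
abbrev karoubiExt (F : C ⥤ C) : Karoubi C ⥤ Karoubi C := (functorExtension₂ C C).obj F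

theorem iter_karoubiExt (T : C ⥤ C) (n : ℕ) : iter (karoubiExt T) n = karoubiExt (iter T n) := by
  induction n with
  | zero => rfl
  | succ n ih => exact congrArg (· ⋙ karoubiExt T) ih

/-- A square in the Karoubi envelope is a pullback if it is induced by a pullback square of the
underlying objects. -/
theorem isPullback_karoubi {P X Y Z : Karoubi C} {fst' : P ⟶ X} {snd' : P ⟶ Y} {f' : X ⟶ Z}
    {g' : Y ⟶ Z} {fst : P.X ⟶ X.X} {snd : P.X ⟶ Y.X} {f : X.X ⟶ Z.X} {g : Y.X ⟶ Z.X}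
    (h : IsPullback fst snd f g) (hfst : fst'.f = P.p ≫ fst) (hsnd : snd'.f = P.p ≫ snd)
    (hf : f'.f = X.p ≫ f) (hg : g'.f = Y.p ≫ g) (hfst' : P.p ≫ fst = fst ≫ X.p)
    (hsnd' : P.p ≫ snd = snd ≫ Y.p) : IsPullback fst' snd' f' g' := by
  have w : fst' ≫ f' = snd' ≫ g' := by
    ext
    simp only [Karoubi.comp_f, hf, hg, Karoubi.comp_p_assoc]
    rw [hfst, hsnd, Category.assoc, Category.assoc, h.w]
  have aux : ∀ s : PullbackCone f' g', s.fst.f ≫ f = s.snd.f ≫ g := fun s => by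
    have := congrArg Karoubi.Hom.f s.condition
    simpa only [Karoubi.comp_f, hf, hg, Karoubi.comp_p_assoc] using this
  -- The lift taken in `C` absorbs the idempotents of its source and target because `P.p` commutes
  -- with both projections; hence it is a morphism of the envelope.
  refine ⟨⟨w⟩, ⟨PullbackCone.IsLimit.mk w (fun s => ⟨h.lift s.fst.f s.snd.f (aux s), ?_⟩) ?_ ?_ ?_⟩⟩
  · apply h.hom_ext
    · simp [hfst']
    · simp [hsnd']
  · intro s
    ext
    simp [hfst, hfst']
  · intro s
    ext
    simp [hsnd, hsnd']
  · intro s m m₁ m₂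
    ext
    apply h.hom_ext
    · rw [h.lift_fst, ← m₁, Karoubi.comp_f, hfst, Karoubi.comp_p_assoc]
    · rw [h.lift_snd, ← m₂, Karoubi.comp_f, hsnd, Karoubi.comp_p_assoc]

/-- A square in the Karoubi envelope is a `T`-pullback if it is induced by a `T`-pullback of the
underlying objects. -/
theorem isTPullback_karoubi {T : C ⥤ C} {P X Y Z : Karoubi C} {fst' : P ⟶ X} {snd' : P ⟶ Y}
    {f' : X ⟶ Z} {g' : Y ⟶ Z} {fst : P.X ⟶ X.X} {snd : P.X ⟶ Y.X} {f : X.X ⟶ Z.X} {g : Y.X ⟶ Z.X}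
    (h : IsTPullback T fst snd f g) (hfst : fst'.f = P.p ≫ fst) (hsnd : snd'.f = P.p ≫ snd)
    (hf : f'.f = X.p ≫ f) (hg : g'.f = Y.p ≫ g) (hfst' : P.p ≫ fst = fst ≫ X.p)
    (hsnd' : P.p ≫ snd = snd ≫ Y.p) : IsTPullback (karoubiExt T) fst' snd' f' g' := by
  intro n
  rw [iter_karoubiExt]
  have hm : ∀ {A B C' : C} {x : A ⟶ B} {y : A ⟶ C'} {z : C' ⟶ B}, x = y ≫ z →
      (iter T n).map x = (iter T n).map y ≫ (iter T n).map z := fun e => by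
    rw [e, Functor.map_comp]
  exact isPullback_karoubi (h n) (hm hfst) (hm hsnd) (hm hf) (hm hg)
    ((hm rfl).symm.trans ((congrArg _ hfst').trans (hm rfl)))
    ((hm rfl).symm.trans ((congrArg _ hsnd').trans (hm rfl)))

/-- The legs of a cone with vertex (X, e) form a cone in `C` with vertex X. Each leg absorbs e,
hence so does the lift, by uniqueness. -/
instance preservesLimit_toKaroubi {J : Type*} [Category* J] (K : J ⥤ C) :
    PreservesLimit K (toKaroubi C) := by
  refine ⟨fun {c} hc => ⟨?_⟩⟩
  let c₀ (s : Cone (K ⋙ toKaroubi C)) : Cone K :=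
    { pt := s.pt.X
      π := { app := fun j => (s.π.app j).f
             naturality := fun i j f => by
              have := congrArg Karoubi.Hom.f (s.w f)
              exact (Category.id_comp _).trans this.symm } }
  refine { lift := fun s => ⟨hc.lift (c₀ s), ?_⟩, fac := ?_, uniq := ?_ }
  · apply hc.hom_ext
    intro j
    have : s.pt.p ≫ (s.π.app j).f = (s.π.app j).f := Karoubi.p_comp _
    change (s.pt.p ≫ hc.lift (c₀ s) ≫ 𝟙 _) ≫ c.π.app j = _
    rw [Category.comp_id, Category.assoc, hc.fac]
    exact this
  · intro s j
    ext
    exact hc.fac (c₀ s) j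
  · intro s m hm
    ext
    exact hc.uniq (c₀ s) m.f (fun j => congrArg Karoubi.Hom.f (hm j))

/-- The image in the envelope of a limit cone of `K` is a limit cone, so it is enough to test
preservation there, where the extension of `F` agrees with `F` up to isomorphism. -/
theorem preservesLimit_karoubiExt {J : Type*} [Category* J] (K : J ⥤ C) [HasLimit K] (F : C ⥤ C)
    [PreservesLimit K F] : PreservesLimit (K ⋙ toKaroubi C) (karoubiExt F) := by
  have e : F ⋙ toKaroubi C ≅ toKaroubi C ⋙ karoubiExt F :=
    ((functorExtension₂CompWhiskeringLeftToKaroubiIso C C).app F).symm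
  have := preservesLimit_of_natIso K e
  exact preservesLimit_of_preserves_limit_cone
    (isLimitOfPreserves (toKaroubi C) (limit.isLimit K))
    (isLimitOfPreserves (toKaroubi C ⋙ karoubiExt F) (limit.isLimit K))

/-- The wide cospan of copies of `q`, with `q` induced by `q₀`, is a retract of the image of the
wide cospan of copies of `q₀`. -/
theorem exists_retract_wideCospan {E M : Karoubi C} (q : E ⟶ M) (q₀ : E.X ⟶ M.X)
    (hq : q.f = E.p ≫ q₀) (hq' : E.p ≫ q₀ = q₀ ≫ M.p) (J : Type) :
    ∃ (i : WidePullbackShape.wideCospan M (fun _ : J => E) (fun _ => q) ⟶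
        WidePullbackShape.wideCospan M.X (fun _ : J => E.X) (fun _ => q₀) ⋙ toKaroubi C)
      (r : WidePullbackShape.wideCospan M.X (fun _ : J => E.X) (fun _ => q₀) ⋙ toKaroubi C ⟶
        WidePullbackShape.wideCospan M (fun _ : J => E) (fun _ => q)), i ≫ r = 𝟙 _ := by
  refine ⟨{ app := fun j => match j with
              | none => M.decompId_i
              | some _ => E.decompId_i
            naturality := ?_ },
          { app := fun j => match j with
              | none => M.decompId_p
              | some _ => E.decompId_p
            naturality := ?_ }, ?_⟩
  · rintro _ _ (j | j)
    · rw [WidePullbackShape.hom_id, CategoryTheory.Functor.map_id,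
        CategoryTheory.Functor.map_id, Category.comp_id, Category.id_comp]
    · apply Karoubi.hom_ext
      change q.f ≫ M.p = E.p ≫ q₀
      rw [Karoubi.comp_p, hq]
  · rintro _ _ (j | j)
    · rw [WidePullbackShape.hom_id, CategoryTheory.Functor.map_id,
        CategoryTheory.Functor.map_id, Category.comp_id, Category.id_comp]
    · apply Karoubi.hom_ext
      change q₀ ≫ M.p = E.p ≫ q.f
      rw [Karoubi.p_comp, hq, hq']
  · ext j
    rcases j with _ | j
    · exact M.idem
    · exact E.idem

/-- Both existence and preservation pass to the retract of `exists_retract_wideCospan`; existence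
uses that idempotents split in the envelope. -/
theorem hasTPowers_karoubi {T : C ⥤ C} {E M : Karoubi C} {q : E ⟶ M} {q₀ : E.X ⟶ M.X}
    (h : HasTPowers T q₀) (hq : q.f = E.p ≫ q₀) (hq' : E.p ≫ q₀ = q₀ ≫ M.p) :
    HasTPowers (karoubiExt T) q := by
  intro n
  obtain ⟨i, r, hir⟩ := exists_retract_wideCospan q q₀ hq hq' (Fin n)
  have := (h n).1
  have : HasLimit (WidePullbackShape.wideCospan M.X (fun _ : Fin n => E.X) (fun _ => q₀) ⋙
    toKaroubi C) := ⟨⟨_, isLimitOfPreserves (toKaroubi C) (limit.isLimit _)⟩⟩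
  refine ⟨hasLimit_of_retract hir, fun m => ?_⟩
  have := (h n).2 m
  rw [iter_karoubiExt]
  have := preservesLimit_karoubiExt
    (WidePullbackShape.wideCospan M.X (fun _ : Fin n => E.X) (fun _ => q₀)) (iter T m)
  exact preservesLimit_of_retract hir _

/-- A morphism of the Karoubi envelope is a tangent display map if it is induced by a tangent display
map of the underlying objects. -/
theorem isTDisplay_karoubi {T : C ⥤ C} {E M : Karoubi C} {q : E ⟶ M} {q₀ : E.X ⟶ M.X}
    (h : IsTDisplay T q₀) (hq : q.f = E.p ≫ q₀) (hq' : E.p ≫ q₀ = q₀ ≫ M.p) :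
    IsTDisplay (karoubiExt T) q := by
  rw [isTDisplay_iff] at h ⊢
  intro n
  rw [iter_karoubiExt]
  intro N f
  obtain ⟨P, fst, snd, sq⟩ := h n f.f
  have : ExistsTPullback (karoubiExt T) ((toKaroubi C).map f.f)
      ((toKaroubi C).map ((iter T n).map q₀)) :=
    ⟨(toKaroubi C).obj P, (toKaroubi C).map fst, (toKaroubi C).map snd,
      isTPullback_karoubi (by exact sq) (Category.id_comp _).symm (Category.id_comp _).symm
        (Category.id_comp _).symm (Category.id_comp _).symm
        ((Category.id_comp _).trans (Category.comp_id _).symm)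
        ((Category.id_comp _).trans (Category.comp_id _).symm)⟩
  have hm : q.f = q₀ ≫ M.p := hq.trans hq'
  -- Each object (X, e) is a retract of (X, id), compatibly with both legs of the cospan.
  refine this.of_retract (iX := N.decompId_i) (rX := N.decompId_p)
    (iY := ((karoubiExt (iter T n)).obj E).decompId_i)
    (rY := ((karoubiExt (iter T n)).obj E).decompId_p)
    (iZ := ((karoubiExt (iter T n)).obj M).decompId_i)
    (rZ := ((karoubiExt (iter T n)).obj M).decompId_p)
    (Karoubi.decompId _).symm (Karoubi.decompId _).symm (Karoubi.decompId _).symm ?_ ?_ ?_ ?_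
  all_goals apply Karoubi.hom_ext
  · exact (Karoubi.p_comp f).trans (Karoubi.comp_p f).symm
  · change (iter T n).map E.p ≫ (iter T n).map q₀ = (iter T n).map q.f ≫ (iter T n).map M.p
    rw [← Functor.map_comp, ← Functor.map_comp, Karoubi.comp_p, hq]
  · exact (Karoubi.p_comp f).trans (Karoubi.comp_p f).symm
  · change (iter T n).map E.p ≫ (iter T n).map q.f = (iter T n).map q₀ ≫ (iter T n).map M.p
    rw [← Functor.map_comp, ← Functor.map_comp, Karoubi.p_comp, hm]

end Karoubi

/-! ### Transfer of equations from the base category to the envelope. -/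

section Induced

variable {C : Type u} [Category.{v} C]

/-- The morphism `f` of the Karoubi envelope is induced by `f₀`. -/
def IsInduced {P Q : Karoubi C} (f : P ⟶ Q) (f₀ : P.X ⟶ Q.X) : Prop := f.f = P.p ≫ f₀

theorem isInduced_id (P : Karoubi C) : IsInduced (𝟙 P) (𝟙 P.X) := (Category.comp_id _).symm

theorem IsInduced.comp {P Q R : Karoubi C} {f : P ⟶ Q} {g : Q ⟶ R} {f₀ : P.X ⟶ Q.X}
    {g₀ : Q.X ⟶ R.X} (hf : IsInduced f f₀) (hg : IsInduced g g₀) :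
    IsInduced (f ≫ g) (f₀ ≫ g₀) := by
  unfold IsInduced at *
  rw [Karoubi.comp_f, hg, Karoubi.comp_p_assoc, hf, Category.assoc]

theorem IsInduced.map {P Q : Karoubi C} {f : P ⟶ Q} {f₀ : P.X ⟶ Q.X} (hf : IsInduced f f₀)
    (F : C ⥤ C) : IsInduced ((karoubiExt F).map f) (F.map f₀) :=
  (congrArg F.map hf).trans (F.map_comp _ _)

theorem isInduced_app {F G : C ⥤ C} (φ : F ⟶ G) (P : Karoubi C) :
    IsInduced (((functorExtension₂ C C).map φ).app P) (φ.app P.X) := rfl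

theorem IsInduced.eq {P Q : Karoubi C} {f g : P ⟶ Q} {f₀ : P.X ⟶ Q.X} (hf : IsInduced f f₀)
    {g₀ : P.X ⟶ Q.X} (hg : IsInduced g g₀) (h : f₀ = g₀) : f = g :=
  Karoubi.hom_ext _ _ (hf.trans ((congrArg (P.p ≫ ·) h).trans hg.symm))

/-- A morphism into `Q` already absorbs `Q.p`, so on generalized elements an induced map acts
exactly as its underlying map. -/
theorem IsInduced.comp_f {P Q R : Karoubi C} {g : Q ⟶ R} {g₀ : Q.X ⟶ R.X} (hg : IsInduced g g₀)
    (f : P ⟶ Q) : (f ≫ g).f = f.f ≫ g₀ := by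
  unfold IsInduced at hg
  rw [Karoubi.comp_f, hg, Karoubi.comp_p_assoc]

end Induced

namespace BundleData

variable {C : Type u} [Category.{v} C]

theorem IsMorphism.map {E M E' M' : C} {B : BundleData E M} {B' : BundleData E' M'} {f : E ⟶ E'}
    {g : M ⟶ M'} (hf : B.IsMorphism B' f g) (F : C ⥤ C)
    (h : IsPullback (F.map B.π₁) (F.map B.π₂) (F.map B.proj) (F.map B.proj))
    (h' : IsPullback (F.map B'.π₁) (F.map B'.π₂) (F.map B'.proj) (F.map B'.proj)) :
    (B.map F h).IsMorphism (B'.map F h') (F.map f) (F.map g) where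
  comm := (F.map_comp _ _).symm.trans ((congrArg F.map hf.comm).trans (F.map_comp _ _))
  zero := (F.map_comp _ _).symm.trans ((congrArg F.map hf.zero).trans (F.map_comp _ _))
  add := by
    have w : (B.π₁ ≫ f) ≫ B'.proj = (B.π₂ ≫ f) ≫ B'.proj := by
      rw [Category.assoc, Category.assoc, hf.comm, B.isPullback.w_assoc]
    have w' : F.map (B.π₁ ≫ f) ≫ F.map B'.proj = F.map (B.π₂ ≫ f) ≫ F.map B'.proj := by
      rw [← F.map_comp, ← F.map_comp, w]
    refine (F.map_comp _ _).symm.trans ((congrArg F.map hf.add).trans ?_)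
    exact (B'.map_sum F h' w w').symm.trans (sum_congr _ w' (F.map_comp _ _) (F.map_comp _ _))

end BundleData

/-! ### The tangent structure on the envelope. -/

namespace TangentStructure

variable {C : Type u} [Category.{v} C] (𝕋 : TangentStructure C)

theorem split_isTPullback (P : Karoubi C) :
    IsTPullback 𝕋.split.T (𝕋.split.π₁.app P) (𝕋.split.π₂.app P) (𝕋.split.p.app P)
      (𝕋.split.p.app P) :=
  isTPullback_karoubi (𝕋.isTPullback P.X) rfl rfl rfl rfl (𝕋.π₁.naturality P.p)
    (𝕋.π₂.naturality P.p)

/-- The bundle `p` over an object of the Karoubi envelope. -/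
abbrev splitBundle (P : Karoubi C) : BundleData (𝕋.split.T.obj P) P :=
  𝕋.split.bundle P (𝕋.split_isTPullback P).isPullback

/-- The bundle `T p` over an object of the Karoubi envelope. -/
abbrev splitBundleMap (P : Karoubi C) :
    BundleData (𝕋.split.T.obj (𝕋.split.T.obj P)) (𝕋.split.T.obj P) :=
  (𝕋.splitBundle P).map 𝕋.split.T (𝕋.split_isTPullback P).map

/-- The bundle `T p` over an object. -/
abbrev tangentBundleMap (M : C) : BundleData (𝕋.T.obj (𝕋.T.obj M)) (𝕋.T.obj M) :=
  (𝕋.tangentBundle M).map 𝕋.T (𝕋.isTPullback M).map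

variable {𝕋} {P W : Karoubi C}

theorem splitBundle_proj_eq {a b : W ⟶ 𝕋.split.T.obj P}
    (h : a ≫ (𝕋.splitBundle P).proj = b ≫ (𝕋.splitBundle P).proj) :
    a.f ≫ (𝕋.tangentBundle P.X).proj = b.f ≫ (𝕋.tangentBundle P.X).proj :=
  ((isInduced_app 𝕋.p P).comp_f a).symm.trans
    ((congrArg Karoubi.Hom.f h).trans ((isInduced_app 𝕋.p P).comp_f b))

theorem splitBundleMap_proj_eq {a b : W ⟶ 𝕋.split.T.obj (𝕋.split.T.obj P)}
    (h : a ≫ (𝕋.splitBundleMap P).proj = b ≫ (𝕋.splitBundleMap P).proj) :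
    a.f ≫ (𝕋.tangentBundleMap P.X).proj = b.f ≫ (𝕋.tangentBundleMap P.X).proj :=
  (((isInduced_app 𝕋.p P).map 𝕋.T).comp_f a).symm.trans
    ((congrArg Karoubi.Hom.f h).trans (((isInduced_app 𝕋.p P).map 𝕋.T).comp_f b))

/-- Sums in the envelope are computed in `C`, which reduces the monoid laws on generalized elements
to those of the original tangent bundle. -/
theorem splitBundle_sum_f {a b : W ⟶ 𝕋.split.T.obj P}
    (h : a ≫ (𝕋.splitBundle P).proj = b ≫ (𝕋.splitBundle P).proj) :
    ((𝕋.splitBundle P).sum a b h).f =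
      (𝕋.tangentBundle P.X).sum a.f b.f (splitBundle_proj_eq h) := by
  have h₁ := congrArg Karoubi.Hom.f ((𝕋.splitBundle P).isPullback.lift_fst a b h)
  have h₂ := congrArg Karoubi.Hom.f ((𝕋.splitBundle P).isPullback.lift_snd a b h)
  set l := (𝕋.splitBundle P).isPullback.lift a b h
  refine Eq.trans ?_ ((𝕋.tangentBundle P.X).sum_eq (splitBundle_proj_eq h) l.f ?_ ?_).symm
  · exact (isInduced_app 𝕋.add P).comp_f l
  · exact ((isInduced_app 𝕋.π₁ P).comp_f l).symm.trans h₁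
  · exact ((isInduced_app 𝕋.π₂ P).comp_f l).symm.trans h₂

theorem splitBundleMap_sum_f {a b : W ⟶ 𝕋.split.T.obj (𝕋.split.T.obj P)}
    (h : a ≫ (𝕋.splitBundleMap P).proj = b ≫ (𝕋.splitBundleMap P).proj) :
    ((𝕋.splitBundleMap P).sum a b h).f =
      (𝕋.tangentBundleMap P.X).sum a.f b.f (splitBundleMap_proj_eq h) := by
  have h₁ := congrArg Karoubi.Hom.f ((𝕋.splitBundleMap P).isPullback.lift_fst a b h)
  have h₂ := congrArg Karoubi.Hom.f ((𝕋.splitBundleMap P).isPullback.lift_snd a b h)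
  set l := (𝕋.splitBundleMap P).isPullback.lift a b h
  refine Eq.trans ?_ ((𝕋.tangentBundleMap P.X).sum_eq (splitBundleMap_proj_eq h) l.f ?_ ?_).symm
  · exact ((isInduced_app 𝕋.add P).map 𝕋.T).comp_f l
  · exact (((isInduced_app 𝕋.π₁ P).map 𝕋.T).comp_f l).symm.trans h₁
  · exact (((isInduced_app 𝕋.π₂ P).map 𝕋.T).comp_f l).symm.trans h₂

theorem isInduced_splitBundle_sum {a b : W ⟶ 𝕋.split.T.obj P} {a₀ b₀ : W.X ⟶ 𝕋.T.obj P.X}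
    (ha : IsInduced a a₀) (hb : IsInduced b b₀)
    (h : a ≫ (𝕋.splitBundle P).proj = b ≫ (𝕋.splitBundle P).proj)
    (h₀ : a₀ ≫ (𝕋.tangentBundle P.X).proj = b₀ ≫ (𝕋.tangentBundle P.X).proj) :
    IsInduced ((𝕋.splitBundle P).sum a b h) ((𝕋.tangentBundle P.X).sum a₀ b₀ h₀) :=
  (splitBundle_sum_f h).trans ((BundleData.sum_congr _ _ ha hb).trans
    (BundleData.comp_sum _ W.p h₀).symm)

theorem isInduced_splitBundleMap_sum {a b : W ⟶ 𝕋.split.T.obj (𝕋.split.T.obj P)}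
    {a₀ b₀ : W.X ⟶ 𝕋.T.obj (𝕋.T.obj P.X)} (ha : IsInduced a a₀) (hb : IsInduced b b₀)
    (h : a ≫ (𝕋.splitBundleMap P).proj = b ≫ (𝕋.splitBundleMap P).proj)
    (h₀ : a₀ ≫ (𝕋.tangentBundleMap P.X).proj = b₀ ≫ (𝕋.tangentBundleMap P.X).proj) :
    IsInduced ((𝕋.splitBundleMap P).sum a b h) ((𝕋.tangentBundleMap P.X).sum a₀ b₀ h₀) :=
  (splitBundleMap_sum_f h).trans ((BundleData.sum_congr _ _ ha hb).trans
    (BundleData.comp_sum _ W.p h₀).symm)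

variable (𝕋 P)

theorem splitBundle_isAdditive : (𝕋.splitBundle P).IsAdditive where
  zero_proj := ((isInduced_app 𝕋.zero P).comp (isInduced_app 𝕋.p P)).eq (isInduced_id P)
    (𝕋.additive P.X).zero_proj
  add_proj := ((isInduced_app 𝕋.add P).comp (isInduced_app 𝕋.p P)).eq
    ((isInduced_app 𝕋.π₁ P).comp (isInduced_app 𝕋.p P)) (𝕋.additive P.X).add_proj
  sum_zero a h := by
    apply Karoubi.hom_ext
    rw [splitBundle_sum_f]
    refine (𝕋.additive P.X).sum_proj_zero _ _ ?_ _
    exact ((isInduced_app 𝕋.p P).comp (isInduced_app 𝕋.zero P)).comp_f a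
  sum_comm a b h := by
    apply Karoubi.hom_ext
    rw [splitBundle_sum_f, splitBundle_sum_f]
    exact (𝕋.additive P.X).sum_comm _ _ _
  sum_assoc a b c h₁ h₂ h₃ h₄ := by
    apply Karoubi.hom_ext
    have e₂ := splitBundle_proj_eq h₂
    have e₄ := splitBundle_proj_eq h₄
    rw [splitBundle_sum_f] at e₂ e₄
    refine (splitBundle_sum_f h₂).trans (Eq.trans ?_ (splitBundle_sum_f h₄).symm)
    refine (BundleData.sum_congr _ _ (splitBundle_sum_f h₁) rfl).trans
      (Eq.trans ?_ (BundleData.sum_congr _ e₄ rfl (splitBundle_sum_f h₃).symm))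
    exact (𝕋.additive P.X).sum_assoc _ _ _ _ e₂ _ e₄

theorem split_ℓ_isMorphism : (𝕋.splitBundle P).IsMorphism (𝕋.splitBundleMap P)
    (𝕋.split.ℓ.app P) (𝕋.split.zero.app P) where
  comm := ((isInduced_app 𝕋.ℓ P).comp ((isInduced_app 𝕋.p P).map 𝕋.T)).eq
    ((isInduced_app 𝕋.p P).comp (isInduced_app 𝕋.zero P)) (𝕋.ℓ_additive P.X).comm
  zero := ((isInduced_app 𝕋.zero P).comp (isInduced_app 𝕋.ℓ P)).eq
    ((isInduced_app 𝕋.zero P).comp ((isInduced_app 𝕋.zero P).map 𝕋.T)) (𝕋.ℓ_additive P.X).zero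
  add := ((isInduced_app 𝕋.add P).comp (isInduced_app 𝕋.ℓ P)).eq
    (isInduced_splitBundleMap_sum ((isInduced_app 𝕋.π₁ P).comp (isInduced_app 𝕋.ℓ P))
      ((isInduced_app 𝕋.π₂ P).comp (isInduced_app 𝕋.ℓ P)) _ _) (𝕋.ℓ_additive P.X).add

theorem split_c_isMorphism : (𝕋.splitBundleMap P).IsMorphism (𝕋.splitBundle (𝕋.split.T.obj P))
    (𝕋.split.c.app P) (𝟙 (𝕋.split.T.obj P)) where
  comm := ((isInduced_app 𝕋.c P).comp (isInduced_app 𝕋.p (𝕋.split.T.obj P))).eq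
    (((isInduced_app 𝕋.p P).map 𝕋.T).comp (isInduced_id _)) (𝕋.c_additive P.X).comm
  zero := (((isInduced_app 𝕋.zero P).map 𝕋.T).comp (isInduced_app 𝕋.c P)).eq
    ((isInduced_id _).comp (isInduced_app 𝕋.zero (𝕋.split.T.obj P))) (𝕋.c_additive P.X).zero
  add := (((isInduced_app 𝕋.add P).map 𝕋.T).comp (isInduced_app 𝕋.c P)).eq
    (isInduced_splitBundle_sum (((isInduced_app 𝕋.π₁ P).map 𝕋.T).comp (isInduced_app 𝕋.c P))
      (((isInduced_app 𝕋.π₂ P).map 𝕋.T).comp (isInduced_app 𝕋.c P)) _ _) (𝕋.c_additive P.X).add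

/-- The top side of the universality square of the vertical lift is natural. -/
theorem universal_naturality {M N : C} (f : M ⟶ N)
    (h : (𝕋.π₁.app N ≫ 𝕋.ℓ.app N) ≫ (𝕋.tangentBundleMap N).proj =
      (𝕋.π₂.app N ≫ 𝕋.zero.app (𝕋.T.obj N)) ≫ (𝕋.tangentBundleMap N).proj)
    (h' : (𝕋.π₁.app M ≫ 𝕋.ℓ.app M) ≫ (𝕋.tangentBundleMap M).proj =
      (𝕋.π₂.app M ≫ 𝕋.zero.app (𝕋.T.obj M)) ≫ (𝕋.tangentBundleMap M).proj) :
    𝕋.T₂.map f ≫ (𝕋.tangentBundleMap N).sum (𝕋.π₁.app N ≫ 𝕋.ℓ.app N)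
      (𝕋.π₂.app N ≫ 𝕋.zero.app (𝕋.T.obj N)) h =
    (𝕋.tangentBundleMap M).sum (𝕋.π₁.app M ≫ 𝕋.ℓ.app M)
      (𝕋.π₂.app M ≫ 𝕋.zero.app (𝕋.T.obj M)) h' ≫ 𝕋.T.map (𝕋.T.map f) := by
  have hf : (𝕋.tangentBundleMap M).IsMorphism (𝕋.tangentBundleMap N) _ _ :=
    (𝕋.isMorphism_map f).map 𝕋.T _ _
  rw [BundleData.comp_sum]
  refine Eq.trans ?_ (BundleData.sum_comp hf h').symm
  refine BundleData.sum_congr _ _ ?_ ?_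
  · exact (𝕋.π₁ ≫ 𝕋.ℓ).naturality f
  · exact (𝕋.π₂ ≫ 𝕋.T.whiskerLeft 𝕋.zero).naturality f

/-- The tangent structure on the Karoubi envelope. -/
noncomputable def karoubi : TangentStructure (Karoubi C) where
  toTangentData := 𝕋.split
  powers P := hasTPowers_karoubi (𝕋.powers P.X) rfl (𝕋.p.naturality P.p)
  isTPullback := 𝕋.split_isTPullback
  additive := 𝕋.splitBundle_isAdditive
  ℓ_additive := 𝕋.split_ℓ_isMorphism
  c_additive := 𝕋.split_c_isMorphism
  c_c P := ((isInduced_app 𝕋.c P).comp (isInduced_app 𝕋.c P)).eq (isInduced_id _) (𝕋.c_c P.X)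
  ℓ_c P := ((isInduced_app 𝕋.ℓ P).comp (isInduced_app 𝕋.c P)).eq (isInduced_app 𝕋.ℓ P)
    (𝕋.ℓ_c P.X)
  ℓ_ℓ P := ((isInduced_app 𝕋.ℓ P).comp ((isInduced_app 𝕋.ℓ P).map 𝕋.T)).eq
    ((isInduced_app 𝕋.ℓ P).comp (isInduced_app 𝕋.ℓ (𝕋.split.T.obj P))) (𝕋.ℓ_ℓ P.X)
  c_c_c P := (((isInduced_app 𝕋.c P).map 𝕋.T).comp
      ((isInduced_app 𝕋.c (𝕋.split.T.obj P)).comp ((isInduced_app 𝕋.c P).map 𝕋.T))).eq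
    ((isInduced_app 𝕋.c (𝕋.split.T.obj P)).comp (((isInduced_app 𝕋.c P).map 𝕋.T).comp
      (isInduced_app 𝕋.c (𝕋.split.T.obj P)))) (𝕋.c_c_c P.X)
  ℓ_c_c P := ((isInduced_app 𝕋.ℓ (𝕋.split.T.obj P)).comp (((isInduced_app 𝕋.c P).map 𝕋.T).comp
      (isInduced_app 𝕋.c (𝕋.split.T.obj P)))).eq
    ((isInduced_app 𝕋.c P).comp ((isInduced_app 𝕋.ℓ P).map 𝕋.T)) (𝕋.ℓ_c_c P.X)
  universal P := isTPullback_karoubi (𝕋.universal P.X)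
    (isInduced_splitBundleMap_sum ((isInduced_app 𝕋.π₁ P).comp (isInduced_app 𝕋.ℓ P))
      ((isInduced_app 𝕋.π₂ P).comp (isInduced_app 𝕋.zero (𝕋.split.T.obj P))) _ _)
    ((isInduced_app 𝕋.π₁ P).comp (isInduced_app 𝕋.p P))
    ((isInduced_app 𝕋.p P).map 𝕋.T)
    (isInduced_app 𝕋.zero P)
    -- Naturality at the idempotent itself is the compatibility condition on the top side of the
    -- square.
    (𝕋.universal_naturality P.p _ _)
    ((𝕋.π₁ ≫ 𝕋.p).naturality P.p)

theorem karoubi_hasNegatives (h : 𝕋.HasNegatives) : 𝕋.karoubi.HasNegatives := by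
  obtain ⟨n, hn⟩ := h
  refine ⟨(functorExtension₂ C C).map n, fun P => ?_⟩
  obtain ⟨h, e⟩ := hn P.X
  refine ⟨((isInduced_app n P).comp (isInduced_app 𝕋.p P)).eq (isInduced_app 𝕋.p P) h, ?_⟩
  exact (isInduced_splitBundle_sum (isInduced_id (𝕋.split.T.obj P)) (isInduced_app n P) _ _).eq
    ((isInduced_app 𝕋.p P).comp (isInduced_app 𝕋.zero P)) e

theorem karoubi_wellDisplayed (h : 𝕋.WellDisplayed) : 𝕋.karoubi.WellDisplayed := fun P =>
  isTDisplay_karoubi (h P.X) rfl (𝕋.p.naturality P.p)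

end TangentStructure

/-! ### Strictness of the embedding. -/

section Embedding

variable {C : Type u} [Category.{v} C]

/-- The two functors send M to (F M, id) and (F M, F id). These are equal by functoriality but not
definitionally, so structure maps are compared by heterogeneous equality. -/
theorem toKaroubi_comp_karoubiExt (F : C ⥤ C) :
    F ⋙ toKaroubi C = toKaroubi C ⋙ karoubiExt F := by
  refine CategoryTheory.Functor.ext (fun M => Karoubi.ext rfl ?_) (fun M N f => ?_)
  · change 𝟙 _ ≫ 𝟙 _ = 𝟙 _ ≫ F.map (𝟙 M)
    rw [F.map_id]
  · ext
    simp only [Karoubi.comp_f, Karoubi.eqToHom_f]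
    change F.map f = (𝟙 _ ≫ 𝟙 _) ≫ F.map f ≫ F.map (𝟙 N) ≫ 𝟙 _
    simp

theorem karoubi_hom_heq {P Q P' Q' : Karoubi C} (hP : P = P') (hQ : Q = Q') {f : P ⟶ Q}
    {g : P' ⟶ Q'} (h : f.f ≍ g.f) : f ≍ g := by
  subst hP hQ
  exact heq_of_eq (Karoubi.hom_ext _ _ (eq_of_heq h))

theorem toKaroubi_map_app_heq {F G : C ⥤ C} (φ : F ⟶ G) (M : C) :
    (toKaroubi C).map (φ.app M) ≍ ((functorExtension₂ C C).map φ).app ((toKaroubi C).obj M) := by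
  refine karoubi_hom_heq (Functor.congr_obj (toKaroubi_comp_karoubiExt F) M)
    (Functor.congr_obj (toKaroubi_comp_karoubiExt G) M) (heq_of_eq ?_)
  change φ.app M = F.map (𝟙 M) ≫ φ.app M
  rw [F.map_id, Category.id_comp]

theorem isStrictEmbedding_toKaroubi (𝕋 : TangentStructure C) :
    IsStrictEmbedding 𝕋 𝕋.karoubi (toKaroubi C) where
  full := inferInstance
  faithful := inferInstance
  obj_injective _ _ h := congrArg Karoubi.X h
  map_T := toKaroubi_comp_karoubiExt 𝕋.T
  map_T₂ := toKaroubi_comp_karoubiExt 𝕋.T₂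
  map_p := toKaroubi_map_app_heq 𝕋.p
  map_π₁ := toKaroubi_map_app_heq 𝕋.π₁
  map_π₂ := toKaroubi_map_app_heq 𝕋.π₂
  map_zero := toKaroubi_map_app_heq 𝕋.zero
  map_add := toKaroubi_map_app_heq 𝕋.add
  map_ℓ := toKaroubi_map_app_heq 𝕋.ℓ
  map_c := toKaroubi_map_app_heq 𝕋.c
  map_powers _ _ := inferInstance

end Embedding

end TangentCat

theorem mainTheorem9 {C : Type u} [Category.{v} C] (𝕋 : TangentCat.TangentStructure C)
    (hneg : 𝕋.HasNegatives) (hdisp : 𝕋.WellDisplayed) :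
    ∃ 𝕊 : TangentCat.TangentStructure (Idempotents.Karoubi C),
      𝕊.toTangentData = 𝕋.toTangentData.split ∧
      TangentCat.IsStrictEmbedding 𝕋 𝕊 (Idempotents.toKaroubi C) ∧
      𝕊.HasNegatives ∧
      𝕊.FullyDisplayed :=
  -- `fullyDisplayed` is applied to the envelope, whose idempotents split, and not to `C`.
  ⟨𝕋.karoubi, rfl, TangentCat.isStrictEmbedding_toKaroubi 𝕋, 𝕋.karoubi_hasNegatives hneg,
    𝕋.karoubi.fullyDisplayed (𝕋.karoubi_hasNegatives hneg) (𝕋.karoubi_wellDisplayed hdisp)⟩
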